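/- Let $S$ be any complex $n\times m$ matrix and let $L$ and $M$ be diagonal, positive semidefinite $m\times m$ matrices. For a complex $n\times n$ matrix $A$ let $\sigma(A)=(\sigma_1(A),\dots,\sigma_n(A))$ denote the vector of its singular values, counted with multiplicity and sorted in non-increasing order; for a square matrix $X$ let $\operatorname{diag}(X)$ denote the diagonal matrix with the same diagonal entries as $X$; and let $S^*$ denote the conjugate transpose of $S$. For $x,y\in\mathbb R^n$, $x$ is weakly majorised by $y$, written $x\prec_w y$, if $\sum_{i=1}^k x_i^\downarrow\le\sum_{i=1}^k y_i^\downarrow$ for every $k=1,\dots,n$, where $x^\downarrow$ is the vector $x$ with its components sorted in non-increasing order. Then $$\sigma\bigl(S\,L\,\operatorname{diag}(S^*S)\,M\,S^*\bigr)\prec_w\sigma\bigl(S\,L\,S^*S\,M\,S^*\bigr).$$ -/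

import Mathlib

open scoped Matrix ComplexOrder

noncomputable section

/-- `x^↓`: the components of the real vector `x`, rearranged in non-increasing order. -/
def sortDesc {n : ℕ} (x : Fin n → ℝ) : Fin n → ℝ :=
  fun i => x (Tuple.sort x i.rev)

/-- `x ≺_w y`: for `k = 1, …, n`, the sum of the `k` largest components of `x` is at most the sum
of the `k` largest components of `y`. Indices start at `0`, so the `k` with `1 ≤ k ≤ n` are the
`j + 1` with `j : Fin n`. -/
def WeaklyMajorised {n : ℕ} (x y : Fin n → ℝ) : Prop :=
  ∀ j : Fin n, ∑ i ∈ Finset.Iic j, sortDesc x i ≤ ∑ i ∈ Finset.Iic j, sortDesc y i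

/-- `σ(A)`: the vector of the `n` singular values of a complex `n × n` matrix `A`, repeated
according to multiplicity and in non-increasing order. -/
def sigmaVec {n : ℕ} (A : Matrix (Fin n) (Fin n) ℂ) : Fin n → ℝ :=
  fun i => (Matrix.toEuclideanLin A).singularValues (i : ℕ)

/-- The diagonal matrix with the same diagonal entries as `A`. -/
def diagPart {m : ℕ} (A : Matrix (Fin m) (Fin m) ℂ) : Matrix (Fin m) (Fin m) ℂ :=
  Matrix.diagonal (fun i => A i i)

end

/-! Write `L = A²`, `M = B²` with `A`, `B` diagonal and nonnegative, and put `E = S A`, `F = S B`,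
`Y = F* E`. Diagonal matrices commute, so the left matrix is `E D F*` with `D = diag(Y)`, and the
right one is `E E* F F*`.

The left matrix is positive, so its `k` largest singular values sum to its trace on a span of
eigenvectors. Cyclicity of the trace turns this into the trace of a compression of `Y D` to a
subspace of dimension at most `k`. Cauchy–Schwarz, AM–GM and averaging over the basis bound the real
part of that trace by the sum of the `k` largest eigenvalues of `Y Y* = F* E E* F`. That matrix is
again positive, so a second cyclic shift gives a compression of `E E* F F*`, and Ky Fan's principle
finishes. -/

open Finset in
/-- A weighted sum of an antitone nonnegative sequence, with weights in `[0, 1]` of total mass at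
most `k`, is at most the sum of the first `k` terms. -/
theorem Antitone.sum_mul_le_sum_range {s : ℕ → ℝ} (hs : Antitone s) (hs0 : ∀ i, 0 ≤ s i) {p k : ℕ}
    {c : Fin p → ℝ} (hc0 : ∀ i, 0 ≤ c i) (hc1 : ∀ i, c i ≤ 1) (hck : ∑ i, c i ≤ k) :
    ∑ i : Fin p, s i * c i ≤ ∑ i ∈ range k, s i := by
  -- Shifting by the threshold `s k` makes the terms with `i ≥ k` nonpositive; the shift costs at
  -- most `k * s k` because the weights sum to at most `k`.
  have h1 : ∀ i : Fin p, (s i - s k) * c i ≤ if (i : ℕ) < k then s i - s k else 0 := by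
    intro i
    split_ifs with h
    · exact mul_le_of_le_one_right (sub_nonneg.2 (hs h.le)) (hc1 i)
    · exact mul_nonpos_of_nonpos_of_nonneg (sub_nonpos.2 (hs (not_lt.1 h))) (hc0 i)
  have h2 : ∑ i : Fin p, (if (i : ℕ) < k then s i - s k else 0) ≤ ∑ i ∈ range k, (s i - s k) := by
    rw [Fin.sum_univ_eq_sum_range (fun i => if i < k then s i - s k else 0), ← sum_filter]
    refine sum_le_sum_of_subset_of_nonneg (fun i hi => ?_) fun i hi _ => ?_
    · simp only [mem_filter, mem_range] at hi ⊢
      exact hi.2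
    · exact sub_nonneg.2 (hs (mem_range.1 hi).le)
  have h3 := (sum_le_sum fun i _ => h1 i).trans h2
  simp only [sub_mul, sum_sub_distrib, ← mul_sum, sum_const, card_range, nsmul_eq_mul] at h3
  nlinarith [mul_le_mul_of_nonneg_left hck (hs0 k)]

/-! ### Weak majorisation as partial sums of singular values. -/

theorem sortDesc_eq_self {n : ℕ} {x : Fin n → ℝ} (hx : Antitone x) : sortDesc x = x := by
  have h : x ∘ (Fin.revPerm : Equiv.Perm (Fin n)) = x ∘ Tuple.sort x :=
    Tuple.comp_sort_eq_comp_iff_monotone.2 (hx.comp Fin.rev_anti)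
  funext i
  have := congrFun h i.rev
  simpa [sortDesc] using this.symm

theorem sum_Iic_sortDesc_sigmaVec {n : ℕ} (A : Matrix (Fin n) (Fin n) ℂ) (j : Fin n) :
    ∑ i ∈ Finset.Iic j, sortDesc (sigmaVec A) i =
      ∑ i ∈ Finset.range (j + 1), (Matrix.toEuclideanLin A).singularValues i := by
  have h : Antitone (sigmaVec A) := fun i k h =>
    (Matrix.toEuclideanLin A).singularValues_antitone h
  rw [sortDesc_eq_self h]
  have h2 : Finset.range (j + 1) = (Finset.Iic j).map Fin.valEmbedding := by
    rw [Fin.map_valEmbedding_Iic]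
    ext i
    simp
  rw [h2, Finset.sum_map]
  rfl

/-! ### Traces of compressions and sums of singular values. -/

section InnerProduct

open Module InnerProductSpace Finset

variable {U V : Type*} [NormedAddCommGroup U] [InnerProductSpace ℂ U]
  [NormedAddCommGroup V] [InnerProductSpace ℂ V]

theorem Orthonormal.sum_norm_inner_sq_le {ι : Type*} [Fintype ι] {w : ι → U}
    (hw : Orthonormal ℂ w) (x : U) : ∑ i, ‖⟪x, w i⟫_ℂ‖ ^ 2 ≤ ‖x‖ ^ 2 := by
  simpa only [norm_inner_symm] using hw.sum_inner_products_le x (s := univ)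

variable [FiniteDimensional ℂ U]

/-- The trace of `A ∘ B` on the span of finitely many orthonormal eigenvectors is the trace of
`B ∘ A` on the image of that span under `B`. -/
theorem exists_orthonormal_sum_inner_comp_eq (A : V →ₗ[ℂ] U) (B : U →ₗ[ℂ] V) {k : ℕ}
    {v : Fin k → U} (hv : Orthonormal ℂ v) {c : Fin k → ℂ} (hc : ∀ i, A (B (v i)) = c i • v i) :
    ∃ (l : ℕ) (w : Fin l → V), l ≤ k ∧ Orthonormal ℂ w ∧
      ∑ i, c i = ∑ j, ⟪w j, B (A (w j))⟫_ℂ := by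
  set P : Submodule ℂ U := Submodule.span ℂ (Set.range v) with hP
  set Q : Submodule ℂ V := P.map B with hQ
  have hvP : ∀ i, v i ∈ P := fun i => Submodule.subset_span ⟨i, rfl⟩
  have hAB : ∀ x ∈ P, A (B x) ∈ P := by
    intro x hx
    induction hx using Submodule.span_induction with
    | mem x h =>
      obtain ⟨i, rfl⟩ := h
      rw [hc]
      exact P.smul_mem _ (hvP i)
    | zero => simp
    | add x y _ _ hx hy => simpa using P.add_mem hx hy
    | smul a x _ hx => simpa using P.smul_mem a hx
  -- `A` and `B` restrict to maps between `P` and `Q = B P`, so the trace can be commuted between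
  -- these two spaces. `Q` may be smaller than `P`, hence only `l ≤ k`.
  let b : P →ₗ[ℂ] Q := B.restrict fun x hx => Submodule.mem_map_of_mem hx
  let a : Q →ₗ[ℂ] P := A.restrict (by
    rintro _ ⟨x, hx, rfl⟩
    exact hAB x hx)
  let e : OrthonormalBasis (Fin k) ℂ P :=
    OrthonormalBasis.mk (v := fun i => (⟨v i, hvP i⟩ : P))
      (by
        rw [← P.subtypeₗᵢ.orthonormal_comp_iff]
        exact hv)
      (by
        rw [top_le_iff, ← Submodule.map_injective_of_injective P.injective_subtype |>.eq_iff,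
          Submodule.map_span, Submodule.map_top, Submodule.range_subtype, ← Set.range_comp]
        rfl)
  have he : ∀ i, (e i : U) = v i := fun i => by simp [e]
  refine ⟨finrank ℂ Q, fun j => (stdOrthonormalBasis ℂ Q j : V), ?_, ?_, ?_⟩
  · calc finrank ℂ Q ≤ finrank ℂ P := Submodule.finrank_map_le B P
      _ = k := by simpa using finrank_eq_card_basis e.toBasis
  · exact (stdOrthonormalBasis ℂ Q).orthonormal.comp_linearIsometry Q.subtypeₗᵢ
  · have h1 : LinearMap.trace ℂ P (a ∘ₗ b) = ∑ i, c i := by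
      rw [LinearMap.trace_eq_sum_inner _ e]
      refine sum_congr rfl fun i _ => ?_
      change ⟪(e i : U), A (B (e i : U))⟫_ℂ = _
      rw [he, hc, inner_smul_right, inner_self_eq_norm_sq_to_K, hv.1 i]
      simp
    rw [← h1, LinearMap.trace_comp_comm', LinearMap.trace_eq_sum_inner _ (stdOrthonormalBasis ℂ Q)]
    rfl

/-- A nonnegative linear map has an orthonormal basis of eigenvectors whose eigenvalues are its
singular values. -/
theorem LinearMap.IsPositive.exists_eigenbasis_singularValues {T : U →ₗ[ℂ] U} (hT : T.IsPositive)
    {p : ℕ} (hp : finrank ℂ U = p) :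
    ∃ e : OrthonormalBasis (Fin p) ℂ U, ∀ i, T (e i) = (T.singularValues i : ℂ) • e i := by
  refine ⟨T.isSymmetric_adjoint_comp_self.eigenvectorBasis hp, fun i => ?_⟩
  have h := T.isSymmetric_adjoint_comp_self.apply_eigenvectorBasis hp i
  set x := T.isSymmetric_adjoint_comp_self.eigenvectorBasis hp i
  rw [← T.sq_singularValues_fin hp i] at h
  have hs := T.singularValues_nonneg i
  set s := T.singularValues i
  have hadj : adjoint T = T := LinearMap.isSymmetric_iff_isSelfAdjoint T |>.1 hT.isSymmetric
  rw [hadj] at h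
  have h' : T (T x) = ((s : ℂ) ^ 2) • x := by simpa using h
  rcases hs.eq_or_lt with h0 | h0
  · rw [← h0] at h' ⊢
    have : ⟪T x, T x⟫_ℂ = 0 := by rw [hT.isSymmetric, h']; simp
    simpa using this
  · rw [← sub_eq_zero]
    -- From `T² x = s² x`, the defect `f` satisfies `T f = -s f`; positivity of `T` with `s > 0`
    -- forces `f = 0`.
    set f := T x - (s : ℂ) • x with hf
    have hTf : T f = -((s : ℂ) • f) := by
      rw [hf, map_sub, map_smul, h', smul_sub, smul_smul, pow_two]
      abel
    have h1 := hT.2 f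
    rw [hTf, inner_neg_left, inner_smul_left, inner_self_eq_norm_sq_to_K] at h1
    have h2 : 0 ≤ -(s * ‖f‖ ^ 2) := by
      simpa [← Complex.ofReal_pow, ← Complex.ofReal_mul] using h1
    have h3 : ‖f‖ ^ 2 ≤ 0 := by
      by_contra! h
      nlinarith [mul_pos h0 h]
    simpa using le_antisymm h3 (sq_nonneg _)

/-- One half of Ky Fan's maximum principle for the sum of the `k` largest singular values. -/
theorem LinearMap.re_sum_inner_le_sum_singularValues (T : U →ₗ[ℂ] U) {l k : ℕ} (hlk : l ≤ k)
    {x : Fin l → U} (hx : Orthonormal ℂ x) :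
    (∑ j, ⟪x j, T (x j)⟫_ℂ).re ≤ ∑ i ∈ Finset.range k, T.singularValues i := by
  set e := T.isSymmetric_adjoint_comp_self.eigenvectorBasis rfl with he
  set s : ℕ → ℝ := fun i => T.singularValues i with hs
  have hsa : Antitone s := T.singularValues_antitone
  have hs0 : ∀ i, 0 ≤ s i := T.singularValues_nonneg
  have hg : ∀ i j, ⟪T (e i), T (e j)⟫_ℂ = if i = j then (s i : ℂ) ^ 2 else 0 := by
    intro i j
    rw [← LinearMap.adjoint_inner_right, ← LinearMap.comp_apply,
      T.isSymmetric_adjoint_comp_self.apply_eigenvectorBasis rfl j, ← T.sq_singularValues_fin rfl j,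
      inner_smul_right, orthonormal_iff_ite.1 e.orthonormal]
    split_ifs with h
    · subst h; simp [hs]
    · simp
  -- Left singular vectors. Where `s i = 0` the inverse is `0`, so `f i = 0`: the family is
  -- orthonormal only off the kernel indices, but Bessel's inequality holds for all of it.
  let f : Fin (finrank ℂ U) → U := fun i => ((s i)⁻¹ : ℂ) • T (e i)
  have hf : Orthonormal ℂ fun i : {i : Fin (finrank ℂ U) // s i ≠ 0} => f i := by
    classical
    rw [orthonormal_iff_ite]
    rintro ⟨i, hi⟩ ⟨j, hj⟩
    simp only [f, inner_smul_left, inner_smul_right, hg, Subtype.mk.injEq]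
    split_ifs with h
    · subst h
      have : (s i : ℂ) ≠ 0 := by exact_mod_cast hi
      simp only [map_inv₀, Complex.conj_ofReal]
      field_simp
    · simp
  have hf0 : ∀ i : Fin (finrank ℂ U), s i = 0 → f i = 0 := fun i h => by simp [f, h]
  have hTe : ∀ i, T (e i) = (s i : ℂ) • f i := by
    intro i
    by_cases h : s i = 0
    · have : ⟪T (e i), T (e i)⟫_ℂ = 0 := by rw [hg, if_pos rfl, h]; simp
      rw [hf0 i h, smul_zero]
      exact inner_self_eq_zero.1 this
    · have : (s i : ℂ) ≠ 0 := by exact_mod_cast h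
      simp [f, smul_smul, this]
  have hfn : ∀ i, ‖f i‖ ^ 2 ≤ 1 := by
    intro i
    by_cases h : s i = 0
    · simp [hf0 i h]
    · simp [hf.1 ⟨i, h⟩]
  have hfx : ∀ y : U, ∑ i, ‖⟪y, f i⟫_ℂ‖ ^ 2 ≤ ‖y‖ ^ 2 := by
    intro y
    classical
    calc ∑ i, ‖⟪y, f i⟫_ℂ‖ ^ 2
        = ∑ i ∈ univ.filter fun i : Fin (finrank ℂ U) => s i ≠ 0, ‖⟪y, f i⟫_ℂ‖ ^ 2 := by
          symm
          apply sum_filter_of_ne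
          intro i _ h hi
          exact h (by simp [hf0 i hi])
      _ = ∑ i : {i : Fin (finrank ℂ U) // s i ≠ 0}, ‖⟪y, f i⟫_ℂ‖ ^ 2 :=
          sum_subtype _ (by simp) _
      _ ≤ _ := hf.sum_norm_inner_sq_le y
  -- AM–GM replaces the products of coefficients by averages of squares, which Bessel bounds both
  -- over `i` and over `j`.
  let c : Fin (finrank ℂ U) → ℝ := fun i =>
    ∑ j, (‖⟪e i, x j⟫_ℂ‖ ^ 2 + ‖⟪x j, f i⟫_ℂ‖ ^ 2) / 2
  have hxT : ∀ j, (⟪x j, T (x j)⟫_ℂ).re ≤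
      ∑ i : Fin (finrank ℂ U), s i * ((‖⟪e i, x j⟫_ℂ‖ ^ 2 + ‖⟪x j, f i⟫_ℂ‖ ^ 2) / 2) := by
    intro j
    have : T (x j) = ∑ i, ⟪e i, x j⟫_ℂ • T (e i) := by
      conv_lhs => rw [← e.sum_repr' (x j)]
      simp
    rw [this, inner_sum, Complex.re_sum]
    refine sum_le_sum fun i _ => ?_
    rw [hTe, inner_smul_right, inner_smul_right]
    calc (⟪e i, x j⟫_ℂ * (s i * ⟪x j, f i⟫_ℂ)).re
        ≤ ‖⟪e i, x j⟫_ℂ * (s i * ⟪x j, f i⟫_ℂ)‖ := Complex.re_le_norm _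
      _ = s i * (‖⟪e i, x j⟫_ℂ‖ * ‖⟪x j, f i⟫_ℂ‖) := by
          rw [norm_mul, norm_mul, Complex.norm_real, Real.norm_of_nonneg (hs0 i)]
          ring
      _ ≤ _ := by
          refine mul_le_mul_of_nonneg_left ?_ (hs0 i)
          nlinarith [sq_nonneg (‖⟪e i, x j⟫_ℂ‖ - ‖⟪x j, f i⟫_ℂ‖)]
  calc (∑ j, ⟪x j, T (x j)⟫_ℂ).re
      ≤ ∑ j, ∑ i : Fin (finrank ℂ U), s i * ((‖⟪e i, x j⟫_ℂ‖ ^ 2 + ‖⟪x j, f i⟫_ℂ‖ ^ 2) / 2) := by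
        rw [Complex.re_sum]
        exact sum_le_sum fun j _ => hxT j
    _ = ∑ i : Fin (finrank ℂ U), s i * c i := by
        rw [sum_comm]
        simp only [c, mul_sum]
    _ ≤ _ := by
        refine hsa.sum_mul_le_sum_range hs0 (fun i => ?_) (fun i => ?_) ?_
        · exact sum_nonneg fun j _ => by positivity
        · have h1 := hx.sum_norm_inner_sq_le (e i)
          have h2 := hx.sum_inner_products_le (f i) (s := univ)
          have h3 := hfn i
          rw [e.orthonormal.1 i] at h1
          simp only [c, ← sum_div, sum_add_distrib]
          linarith
        · simp only [c]
          rw [sum_comm]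
          calc ∑ j, ∑ i, (‖⟪e i, x j⟫_ℂ‖ ^ 2 + ‖⟪x j, f i⟫_ℂ‖ ^ 2) / 2
              ≤ ∑ j : Fin l, (1 : ℝ) := by
                refine sum_le_sum fun j _ => ?_
                have h1 := e.orthonormal.sum_inner_products_le (x j) (s := univ)
                have h2 := hfx (x j)
                rw [hx.1 j] at h1 h2
                simp only [← sum_div, sum_add_distrib]
                linarith
            _ ≤ k := by simpa using hlk

theorem LinearMap.norm_adjoint_apply_sq_eq_sum [FiniteDimensional ℂ V] (Y : V →ₗ[ℂ] U) {p : ℕ}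
    (e : OrthonormalBasis (Fin p) ℂ U) {s : Fin p → ℝ}
    (he : ∀ i, (Y ∘ₗ adjoint Y) (e i) = (s i : ℂ) • e i) (x : U) :
    ‖adjoint Y x‖ ^ 2 = ∑ i, s i * ‖⟪e i, x⟫_ℂ‖ ^ 2 := by
  have h : ⟪adjoint Y x, adjoint Y x⟫_ℂ = ∑ i, (s i : ℂ) * (‖⟪e i, x⟫_ℂ‖ : ℂ) ^ 2 := by
    rw [LinearMap.adjoint_inner_left, ← LinearMap.comp_apply, ← e.sum_inner_mul_inner]
    refine sum_congr rfl fun i _ => ?_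
    rw [← Y.isPositive_self_comp_adjoint.isSymmetric, he, inner_smul_left, Complex.conj_ofReal,
      mul_left_comm, ← inner_conj_symm x, Complex.conj_mul']
  rw [inner_self_eq_norm_sq_to_K] at h
  apply Complex.ofReal_injective
  push_cast
  exact h

/-- If `D` is the diagonal part of `Y` in an orthonormal basis, then the real part of the trace of a
compression of `Y ∘ D` to a subspace of dimension at most `k` is at most the sum of the `k` largest
eigenvalues of `Y ∘ Y†`. -/
theorem LinearMap.re_sum_inner_comp_diag_le (Y D : U →ₗ[ℂ] U) {ι : Type*} [Fintype ι]
    (b : OrthonormalBasis ι ℂ U) (hD : ∀ r x, ⟪b r, D x⟫_ℂ = ⟪b r, Y (b r)⟫_ℂ * ⟪b r, x⟫_ℂ)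
    {l k : ℕ} (hlk : l ≤ k) {w : Fin l → U} (hw : Orthonormal ℂ w) :
    (∑ j, ⟪w j, Y (D (w j))⟫_ℂ).re ≤
      ∑ i ∈ Finset.range k, (Y ∘ₗ adjoint Y).singularValues i := by
  obtain ⟨e, he⟩ := Y.isPositive_self_comp_adjoint.exists_eigenbasis_singularValues rfl
  set T := Y ∘ₗ adjoint Y with hT
  set s : ℕ → ℝ := fun i => T.singularValues i with hs
  have hsa : Antitone s := T.singularValues_antitone
  have hs0 : ∀ i, 0 ≤ s i := T.singularValues_nonneg
  have hY := Y.norm_adjoint_apply_sq_eq_sum e he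
  have hDn : ∀ x, ‖D x‖ ^ 2 ≤
      ∑ i : Fin (finrank ℂ U), s i * ∑ r, ‖⟪e i, b r⟫_ℂ‖ ^ 2 * ‖⟪b r, x⟫_ℂ‖ ^ 2 := by
    intro x
    calc ‖D x‖ ^ 2 = ∑ r, ‖⟪b r, D x⟫_ℂ‖ ^ 2 := (b.sum_sq_norm_inner_right _).symm
      -- A diagonal entry of `Y` is `⟪adjoint Y (b r), b r⟫`, at most the norm of its row.
      _ ≤ ∑ r, ‖adjoint Y (b r)‖ ^ 2 * ‖⟪b r, x⟫_ℂ‖ ^ 2 := by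
        refine sum_le_sum fun r _ => ?_
        rw [hD, norm_mul, mul_pow, ← LinearMap.adjoint_inner_left]
        gcongr
        simpa [b.orthonormal.1 r] using norm_inner_le_norm (𝕜 := ℂ) (adjoint Y (b r)) (b r)
      _ = _ := by
        simp only [hY, sum_mul, mul_sum]
        rw [sum_comm]
        exact sum_congr rfl fun i _ => sum_congr rfl fun r _ => mul_assoc _ _ _
  -- The second summand comes from `D`: the squared moduli `‖⟪e i, b r⟫‖ ^ 2` form a doubly
  -- stochastic array, so it obeys the same bounds as the first.
  let c : Fin (finrank ℂ U) → ℝ := fun i =>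
    ∑ j, (‖⟪e i, w j⟫_ℂ‖ ^ 2 + ∑ r, ‖⟪e i, b r⟫_ℂ‖ ^ 2 * ‖⟪b r, w j⟫_ℂ‖ ^ 2) / 2
  calc (∑ j, ⟪w j, Y (D (w j))⟫_ℂ).re
      ≤ ∑ j, (‖adjoint Y (w j)‖ ^ 2 + ‖D (w j)‖ ^ 2) / 2 := by
        rw [Complex.re_sum]
        refine sum_le_sum fun j _ => ?_
        rw [← LinearMap.adjoint_inner_left]
        have h := (Complex.re_le_norm _).trans
          (norm_inner_le_norm (𝕜 := ℂ) (adjoint Y (w j)) (D (w j)))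
        nlinarith [sq_nonneg (‖adjoint Y (w j)‖ - ‖D (w j)‖)]
    _ ≤ ∑ j, ∑ i : Fin (finrank ℂ U), s i *
          ((‖⟪e i, w j⟫_ℂ‖ ^ 2 + ∑ r, ‖⟪e i, b r⟫_ℂ‖ ^ 2 * ‖⟪b r, w j⟫_ℂ‖ ^ 2) / 2) := by
        refine sum_le_sum fun j _ => ?_
        have h := hDn (w j)
        simp only [mul_div_assoc', ← sum_div, mul_add, sum_add_distrib]
        rw [hY]
        gcongr
    _ = ∑ i : Fin (finrank ℂ U), s i * c i := by
        rw [sum_comm]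
        simp only [c, mul_sum]
    _ ≤ _ := by
        refine hsa.sum_mul_le_sum_range hs0 (fun i => ?_) (fun i => ?_) ?_
        · exact sum_nonneg fun j _ => by positivity
        · have h1 := hw.sum_norm_inner_sq_le (e i)
          have h2 : ∑ j, ∑ r, ‖⟪e i, b r⟫_ℂ‖ ^ 2 * ‖⟪b r, w j⟫_ℂ‖ ^ 2 ≤ 1 := by
            rw [sum_comm]
            calc ∑ r, ∑ j, ‖⟪e i, b r⟫_ℂ‖ ^ 2 * ‖⟪b r, w j⟫_ℂ‖ ^ 2
                ≤ ∑ r, ‖⟪e i, b r⟫_ℂ‖ ^ 2 := by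
                  refine sum_le_sum fun r _ => ?_
                  rw [← mul_sum]
                  refine mul_le_of_le_one_right (sq_nonneg _) ?_
                  simpa [b.orthonormal.1 r] using hw.sum_norm_inner_sq_le (b r)
              _ = 1 := by simp [b.sum_sq_norm_inner_left, e.orthonormal.1 i]
          rw [e.orthonormal.1 i] at h1
          simp only [c, ← sum_div, sum_add_distrib]
          linarith
        · simp only [c]
          rw [sum_comm]
          calc ∑ j, ∑ i, (‖⟪e i, w j⟫_ℂ‖ ^ 2 +
                ∑ r, ‖⟪e i, b r⟫_ℂ‖ ^ 2 * ‖⟪b r, w j⟫_ℂ‖ ^ 2) / 2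
              = ∑ j : Fin l, (1 : ℝ) := by
                refine sum_congr rfl fun j _ => ?_
                have h2 : ∑ i, ∑ r, ‖⟪e i, b r⟫_ℂ‖ ^ 2 * ‖⟪b r, w j⟫_ℂ‖ ^ 2 = 1 := by
                  rw [sum_comm]
                  simp only [← sum_mul, e.sum_sq_norm_inner_right, b.orthonormal.1, one_pow,
                    one_mul, b.sum_sq_norm_inner_right, hw.1]
                simp only [← sum_div, sum_add_distrib, h2, e.sum_sq_norm_inner_right, hw.1]
                norm_num
            _ ≤ k := by simpa using hlk

/-- Positivity makes the singular values eigenvalues, so their partial sum is a trace, which can be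
moved to `V` by cyclicity. Used for both cyclic shifts. -/
theorem LinearMap.IsPositive.exists_orthonormal_sum_singularValues_eq {A : V →ₗ[ℂ] U}
    {B : U →ₗ[ℂ] V} (h : (A ∘ₗ B).IsPositive) (k : ℕ) :
    ∃ (l : ℕ) (w : Fin l → V), l ≤ k ∧ Orthonormal ℂ w ∧
      ∑ i ∈ Finset.range k, (A ∘ₗ B).singularValues i = (∑ j, ⟪w j, B (A (w j))⟫_ℂ).re := by
  obtain ⟨e, he⟩ := h.exists_eigenbasis_singularValues rfl
  -- `k` may exceed the dimension; singular values beyond it vanish.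
  set p := min k (finrank ℂ U)
  obtain ⟨l, w, hl, hw, hsum⟩ := exists_orthonormal_sum_inner_comp_eq A B
    (v := fun i : Fin p => e (i.castLE (min_le_right _ _)))
    (e.orthonormal.comp _ (Fin.castLE_injective _)) fun i => he _
  refine ⟨l, w, hl.trans (min_le_left _ _), hw, ?_⟩
  rw [← hsum, Complex.re_sum]
  simp only [Complex.ofReal_re, Fin.val_castLE]
  rw [Fin.sum_univ_eq_sum_range (fun i => (A ∘ₗ B).singularValues i)]
  refine (sum_subset (range_subset_range.2 (min_le_left _ _)) fun i hi hi' => ?_).symm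
  refine LinearMap.singularValues_of_finrank_le _ ?_
  simp only [Finset.mem_range, lt_min_iff] at hi hi'
  by_contra! hlt
  exact hi' ⟨hi, hlt⟩

/-- If `D` is the diagonal part of `F† ∘ E` in an orthonormal basis, and `E ∘ D ∘ F†` is positive,
then the singular values of `E ∘ D ∘ F†` are weakly majorised by those of `E ∘ E† ∘ F ∘ F†`. -/
theorem LinearMap.sum_singularValues_comp_diag_comp_adjoint_le [FiniteDimensional ℂ V]
    (E F : V →ₗ[ℂ] U) (D : V →ₗ[ℂ] V) {ι : Type*} [Fintype ι] (b : OrthonormalBasis ι ℂ V)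
    (hD : ∀ r x, ⟪b r, D x⟫_ℂ = ⟪b r, adjoint F (E (b r))⟫_ℂ * ⟪b r, x⟫_ℂ)
    (hpos : ((E ∘ₗ D) ∘ₗ adjoint F).IsPositive) (k : ℕ) :
    ∑ i ∈ Finset.range k, ((E ∘ₗ D) ∘ₗ adjoint F).singularValues i ≤
      ∑ i ∈ Finset.range k, (E ∘ₗ adjoint E ∘ₗ F ∘ₗ adjoint F).singularValues i := by
  obtain ⟨l, w, hl, hw, hsum⟩ := hpos.exists_orthonormal_sum_singularValues_eq k
  have h1 := (adjoint F ∘ₗ E).re_sum_inner_comp_diag_le D b hD hl hw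
  have hEF : (adjoint F ∘ₗ E) ∘ₗ adjoint (adjoint F ∘ₗ E) =
      adjoint F ∘ₗ (E ∘ₗ adjoint E ∘ₗ F) := by
    rw [LinearMap.adjoint_comp, LinearMap.adjoint_adjoint]
    rfl
  have hpos' := (adjoint F ∘ₗ E).isPositive_self_comp_adjoint
  rw [hEF] at h1 hpos'
  obtain ⟨l', w', hl', hw', hsum'⟩ := hpos'.exists_orthonormal_sum_singularValues_eq k
  calc _ = _ := hsum
    _ ≤ _ := h1
    _ = _ := hsum'
    _ ≤ _ := LinearMap.re_sum_inner_le_sum_singularValues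
      (E ∘ₗ adjoint E ∘ₗ F ∘ₗ adjoint F) hl' hw'

end InnerProduct

/-! ### Translation to matrices and the choice of `E` and `F`. -/

theorem Matrix.IsDiag.exists_eq_diagonal_sq_of_posSemidef {m : ℕ} {L : Matrix (Fin m) (Fin m) ℂ}
    (hd : L.IsDiag) (hL : L.PosSemidef) :
    ∃ a : Fin m → ℝ, (∀ i, 0 ≤ a i) ∧
      L = Matrix.diagonal (fun i => (a i : ℂ)) * Matrix.diagonal (fun i => (a i : ℂ)) := by
  refine ⟨fun i => √(L i i).re, fun i => Real.sqrt_nonneg _, ?_⟩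
  conv_lhs => rw [← hd.diagonal_diag]
  rw [Matrix.diagonal_mul_diagonal]
  congr 1
  funext i
  have h := Complex.nonneg_iff.1 (hL.diag_nonneg (i := i))
  rw [← Complex.ofReal_mul, Real.mul_self_sqrt h.1]
  exact Complex.ext rfl (by simpa using h.2.symm)

theorem Matrix.weaklyMajorised_sigmaVec_mul_diagPart_mul {n m : ℕ} (E F : Matrix (Fin n) (Fin m) ℂ)
    (hpos : (E * diagPart (Fᴴ * E) * Fᴴ).PosSemidef) :
    WeaklyMajorised (sigmaVec (E * diagPart (Fᴴ * E) * Fᴴ)) (sigmaVec (E * (Eᴴ * (F * Fᴴ)))) := by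
  intro j
  rw [sum_Iic_sortDesc_sigmaVec, sum_Iic_sortDesc_sigmaVec]
  rw [← Matrix.isPositive_toEuclideanLin_iff] at hpos
  simp only [Matrix.toEuclideanLin, Matrix.toLpLin_mul 2 2 2] at hpos ⊢
  simp only [Matrix.toEuclideanLin_conjTranspose_eq_adjoint] at hpos ⊢
  refine LinearMap.sum_singularValues_comp_diag_comp_adjoint_le _ _ _
    (EuclideanSpace.basisFun (Fin m) ℂ) (fun r x => ?_) hpos _
  rw [← Matrix.toEuclideanLin_conjTranspose_eq_adjoint, ← LinearMap.comp_apply]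
  simp only [Matrix.toEuclideanLin, ← Matrix.toLpLin_mul 2 2 2]
  simp only [diagPart, EuclideanSpace.basisFun_apply, EuclideanSpace.inner_single_left, map_one,
    one_mul, Matrix.toLpLin_apply, Matrix.mulVec_diagonal]
  simp

theorem lemma1 (n m : ℕ) (S : Matrix (Fin n) (Fin m) ℂ) (L M : Matrix (Fin m) (Fin m) ℂ)
    (hLdiag : L.IsDiag) (hL : L.PosSemidef) (hMdiag : M.IsDiag) (hM : M.PosSemidef) :
    WeaklyMajorised
      (sigmaVec (S * L * diagPart (Sᴴ * S) * M * Sᴴ))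
      (sigmaVec (S * L * Sᴴ * S * M * Sᴴ)) := by
  obtain ⟨a, ha, rfl⟩ := hLdiag.exists_eq_diagonal_sq_of_posSemidef hL
  obtain ⟨b, hb, rfl⟩ := hMdiag.exists_eq_diagonal_sq_of_posSemidef hM
  set A := Matrix.diagonal fun i => (a i : ℂ) with hA
  set B := Matrix.diagonal fun i => (b i : ℂ) with hB
  have hAH : Aᴴ = A := by
    rw [hA, Matrix.diagonal_conjTranspose]
    congr 1
    funext i
    simp
  have hBH : Bᴴ = B := by
    rw [hB, Matrix.diagonal_conjTranspose]
    congr 1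
    funext i
    simp
  have hD : diagPart ((S * B)ᴴ * (S * A)) = B * diagPart (Sᴴ * S) * A := by
    rw [Matrix.conjTranspose_mul, hBH, Matrix.mul_assoc, ← Matrix.mul_assoc Sᴴ,
      ← Matrix.mul_assoc B]
    simp only [diagPart, hA, hB, Matrix.diagonal_mul_diagonal, Matrix.mul_diagonal,
      Matrix.diagonal_mul]
  have hcomm : A * (B * diagPart (Sᴴ * S) * A) * B = A * A * diagPart (Sᴴ * S) * (B * B) := by
    simp only [diagPart, hA, hB, Matrix.diagonal_mul_diagonal]
    congr 1
    funext i
    ring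
  have hleft : S * (A * A) * diagPart (Sᴴ * S) * (B * B) * Sᴴ =
      S * A * diagPart ((S * B)ᴴ * (S * A)) * (S * B)ᴴ := by
    rw [hD, Matrix.conjTranspose_mul, hBH]
    have := congrArg (fun X => S * X * Sᴴ) hcomm
    simpa only [Matrix.mul_assoc] using this.symm
  have hright : S * (A * A) * Sᴴ * S * (B * B) * Sᴴ =
      S * A * ((S * A)ᴴ * (S * B * (S * B)ᴴ)) := by
    simp only [Matrix.conjTranspose_mul, hAH, hBH, Matrix.mul_assoc]
  -- A product of nonnegative diagonal matrices is positive semidefinite, and conjugation by `S`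
  -- preserves this.
  have hpos : (S * (A * A) * diagPart (Sᴴ * S) * (B * B) * Sᴴ).PosSemidef := by
    have h : (A * A * diagPart (Sᴴ * S) * (B * B)).PosSemidef := by
      simp only [diagPart, hA, hB, Matrix.diagonal_mul_diagonal]
      refine Matrix.PosSemidef.diagonal fun i => ?_
      have h1 := (Matrix.posSemidef_conjTranspose_mul_self S).diag_nonneg (i := i)
      have h2 : (0 : ℂ) ≤ a i := by exact_mod_cast ha i
      have h3 : (0 : ℂ) ≤ b i := by exact_mod_cast hb i
      positivity
    simpa only [Matrix.mul_assoc] using h.mul_mul_conjTranspose_same S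
  rw [hleft] at hpos ⊢
  rw [hright]
  exact Matrix.weaklyMajorised_sigmaVec_mul_diagPart_mul _ _ hpos
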